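/- A Bratteli diagram $D$ consists of finite sets of vertices $V_i$ and of edges $E_i$ ($i\ge 1$) together with maps $\mathbf{o}:E_i\to V_i$ and $\mathbf{t}:E_i\to V_{i+1}$. A path of length $n\in\{0,1,2,\ldots\}\cup\{\infty\}$ is a sequence of edges $e_i\in E_i$, $1\le i\le n$, with $\mathbf{t}(e_i)=\mathbf{o}(e_{i+1})$ (a path of length $0$ is a vertex of $V_1$). The set $\Omega$ of infinite paths carries the topology induced from the product $\prod_i E_i$ of discrete sets. For $v\in V_i$ let $\Omega_v$ be the set of paths of length $i-1$ ending in $v$, and for a finite path $w$ let $w\Omega\subset\Omega$ be the set of infinite paths beginning with $w$. For $w,u\in\Omega_v$ let $T_{w,u}:w\Omega\to u\Omega$ be the map that replaces the beginning $w$ by $u$. A germ $(F,x)$, i.e. the class of a map $F$ modulo equality on a neighborhood of the point $x$, is called a tail germ if it is the germ at $x$ of some $T_{w,u}$ with $x\in w\Omega$. A homeomorphism $F:\Omega\to\Omega$ is of bounded type if (a) the number $\alpha_v(F)$ of paths $w\in\Omega_v$ such that $F|_{w\Omega}$ is not equal to $T_{w,u}$ for any $u\in\Omega_v$ is bounded uniformly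 over all vertices $v\in\bigcup_i V_i$; and (b) the set of $x\in\Omega$ for which $(F,x)$ is not a tail germ is finite. For a group $G$ acting by homeomorphisms on $\Omega$, the isotropy group at $x\in\Omega$ of its groupoid of germs is the group of all germs $(g,x)$ with $g\in G$, $g(x)=x$, under composition. A group $G$ is amenable if there is a finitely additive map $\mu$ from the set of all subsets of $G$ to $[0,1]$ with $\mu(G)=1$ and $\mu(gA)=\mu(A)$ for all $g\in G$, $A\subset G$. **Theorem.** Let $D$ be a Bratteli diagram and let $G$ be a group acting faithfully on the path space $\Omega$ of $D$ by homeomorphisms of bounded type. If for every $x\in\Omega$ the isotropy group at $x$ of the groupoid of germs of $G$ is amenable, then the group $G$ is amenable. -/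

import Mathlib

open Filter Topology CategoryTheory

/-! ### Amenability -/

/-- An action of a discrete group `G` on a set `X` is amenable if there is an invariant mean on `X`:
a finitely additive, `G`-invariant map from the set of all subsets of `X` to `[0, 1]`
giving the value `1` to `X`. -/
def IsAmenableAction (G X : Type*) [Group G] [MulAction G X] : Prop :=
  ∃ μ : Set X → ℝ,
    (∀ A, μ A ∈ Set.Icc (0 : ℝ) 1) ∧
    μ Set.univ = 1 ∧
    (∀ A B, Disjoint A B → μ (A ∪ B) = μ A + μ B) ∧
    (∀ (g : G) (A : Set X), μ ((fun x => g • x) '' A) = μ A)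

/-- A (discrete) group is amenable if its action on itself by left multiplication is amenable. -/
def IsAmenableGroup (G : Type*) [Group G] : Prop :=
  IsAmenableAction G G

/-! ### The groupoid of germs of an action -/

section Germs

variable (G : Type*) {X : Type*} [TopologicalSpace X] [Group G] [MulAction G X]

/-- Two elements of `G` mapping `x` to `y` define the same germ at `x` if they coincide on a
neighborhood of `x`. -/
def germSetoid (x y : X) : Setoid {g : G // g • x = y} where
  r g h := ∀ᶠ z in 𝓝 x, g.1 • z = h.1 • z
  iseqv :=
    { refl := fun _ => Eventually.of_forall fun _ => rfl
      symm := fun h => h.mono fun _ hz => hz.symm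
      trans := fun h₁ h₂ => (h₁.and h₂).mono fun _ hz => hz.1.trans hz.2 }

/-- The germs `(g, x)`, `g ∈ G`, with origin `x` and target `y`. -/
def ActionGerm (x y : X) : Type _ := Quotient (germSetoid G x y)

variable {G}

/-- The germ `(g, x)`. -/
def ActionGerm.mk {x y : X} (g : G) (h : g • x = y) : ActionGerm G x y :=
  Quotient.mk (germSetoid G x y) ⟨g, h⟩

theorem ActionGerm.exists_rep {x y : X} (a : ActionGerm G x y) :
    ∃ (g : G) (h : g • x = y), a = ActionGerm.mk g h := by
  obtain ⟨⟨g, h⟩, rfl⟩ := Quotient.exists_rep a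
  exact ⟨g, h, rfl⟩

theorem ActionGerm.mk_eq_mk_iff {x y : X} {g g' : G} {h : g • x = y} {h' : g' • x = y} :
    ActionGerm.mk g h = ActionGerm.mk g' h' ↔ ∀ᶠ z in 𝓝 x, g • z = g' • z :=
  Quotient.eq (r := germSetoid G x y)

theorem tendsto_smul_of_smul_eq [ContinuousConstSMul G X] {x y : X} {g : G} (h : g • x = y) :
    Tendsto (fun p : X => g • p) (𝓝 x) (𝓝 y) :=
  h ▸ (continuous_const_smul g).tendsto x

variable [ContinuousConstSMul G X]

/-- The product `(h, g x)(g, x) = (h g, x)` of germs, with the germ applied first written first. -/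
def ActionGerm.comp {x y z : X} : ActionGerm G x y → ActionGerm G y z → ActionGerm G x z :=
  Quotient.map₂ (sa := germSetoid G x y) (sb := germSetoid G y z) (sc := germSetoid G x z)
    (fun g h => ⟨h.1 * g.1, by rw [mul_smul, g.2, h.2]⟩)
    (by
      intro g g' hg h h' hh
      change ∀ᶠ p in 𝓝 x, (h.1 * g.1) • p = (h'.1 * g'.1) • p
      filter_upwards [(tendsto_smul_of_smul_eq g.2).eventually hh, hg] with p hp hp'
      rw [mul_smul, mul_smul, hp, hp'])

/-- The inverse `(g, x)⁻¹ = (g⁻¹, g x)` of a germ. -/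
def ActionGerm.inv {x y : X} : ActionGerm G x y → ActionGerm G y x :=
  Quotient.map (sa := germSetoid G x y) (sb := germSetoid G y x)
    (fun g => ⟨g.1⁻¹, by rw [inv_smul_eq_iff, g.2]⟩)
    (by
      intro g g' hg
      have hx : g'.1⁻¹ • y = x := by rw [inv_smul_eq_iff, g'.2]
      change ∀ᶠ p in 𝓝 y, g.1⁻¹ • p = g'.1⁻¹ • p
      filter_upwards [(tendsto_smul_of_smul_eq hx).eventually hg] with p hp
      rw [inv_smul_eq_iff, hp, smul_inv_smul])

/-- The objects of the groupoid of germs of the action of `G` on `X`: the points of `X`. -/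
structure GermGroupoid (G X : Type*) where
  /-- the underlying point of `X` -/
  point : X

/-- The groupoid of germs of the action of `G` on `X`. -/
instance germGroupoid : Groupoid (GermGroupoid G X) where
  Hom x y := ActionGerm G x.point y.point
  id x := ActionGerm.mk 1 (one_smul G x.point)
  comp a b := ActionGerm.comp a b
  id_comp a := by
    obtain ⟨g, h, rfl⟩ := a.exists_rep
    exact congrArg (Quotient.mk _) (Subtype.ext (mul_one g))
  comp_id a := by
    obtain ⟨g, h, rfl⟩ := a.exists_rep
    exact congrArg (Quotient.mk _) (Subtype.ext (one_mul g))
  assoc a b c := by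
    obtain ⟨g, hg, rfl⟩ := a.exists_rep
    obtain ⟨h, hh, rfl⟩ := b.exists_rep
    obtain ⟨k, hk, rfl⟩ := c.exists_rep
    exact congrArg (Quotient.mk _) (Subtype.ext (mul_assoc k h g).symm)
  inv a := ActionGerm.inv a
  inv_comp a := by
    obtain ⟨g, h, rfl⟩ := a.exists_rep
    exact congrArg (Quotient.mk _) (Subtype.ext (mul_inv_cancel g))
  comp_inv a := by
    obtain ⟨g, h, rfl⟩ := a.exists_rep
    exact congrArg (Quotient.mk _) (Subtype.ext (inv_mul_cancel g))

variable (G)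

/-- The isotropy group (group of germs) at `x` of the groupoid of germs: all germs with origin and
target `x`. Its group structure is that of the vertex group of a groupoid. -/
abbrev IsotropyGroup (x : X) : Type _ :=
  (GermGroupoid.mk x : GermGroupoid G X) ⟶ GermGroupoid.mk x

end Germs

/-! ### Bratteli diagrams -/

/-- A Bratteli diagram. The levels are numbered `0, 1, 2, …`; the edges in `E i` go from level `i`
to level `i + 1`. -/
structure BratteliDiagram where
  V : ℕ → Type*
  E : ℕ → Type*
  finite_V : ∀ i, Finite (V i)
  finite_E : ∀ i, Finite (E i)
  src : ∀ {i}, E i → V i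
  tgt : ∀ {i}, E i → V (i + 1)

namespace BratteliDiagram

/-- The set of infinite paths starting on the first level. -/
def PathSpace (D : BratteliDiagram) : Type _ :=
  {e : ∀ i, D.E i // ∀ i, D.tgt (e i) = D.src (e (i + 1))}

/-- The topology of a subset of the product of the discrete sets of edges. -/
instance (D : BratteliDiagram) : TopologicalSpace D.PathSpace :=
  TopologicalSpace.induced (fun p => (p.1 : ∀ i, D.E i))
    (@Pi.topologicalSpace ℕ D.E (fun _ => ⊥))

/-- Paths of length `n` starting on the first level, with the vertices they pass through
recorded (a path of length `0` is a vertex of the first level). -/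
structure FinPath (D : BratteliDiagram) (n : ℕ) where
  vert : ∀ i : Fin (n + 1), D.V i
  edge : ∀ i : Fin n, D.E i
  src_edge : ∀ i : Fin n, D.src (edge i) = vert i.castSucc
  tgt_edge : ∀ i : Fin n, D.tgt (edge i) = vert i.succ

variable {D : BratteliDiagram}

/-- The vertex in which a finite path ends. -/
def FinPath.endpoint {n : ℕ} (w : D.FinPath n) : D.V n := w.vert (Fin.last n)

/-- The set `wΩ` of infinite paths beginning with `w`. (The condition on the first vertex is
automatic if `w` has positive length.) -/
def FinPath.cylinder {n : ℕ} (w : D.FinPath n) : Set D.PathSpace :=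
  {p | D.src (p.1 0) = w.vert 0 ∧ ∀ i : Fin n, p.1 i = w.edge i}

theorem FinPath.src_of_mem_cylinder {n : ℕ} {w : D.FinPath n} {p : D.PathSpace}
    (hp : p ∈ w.cylinder) : D.src (p.1 n) = w.endpoint := by
  cases n with
  | zero => exact hp.1
  | succ m =>
    rw [← p.2 m]
    exact (congrArg D.tgt (hp.2 (Fin.last m))).trans (w.tgt_edge (Fin.last m))

/-- The transformation `T_{w, u} : wΩ → uΩ`, replacing the beginning `w` by `u`, for finite paths
`w`, `u` of the same length ending in the same vertex. -/
def tailMap {n : ℕ} (w u : D.FinPath n) (h : w.endpoint = u.endpoint) (p : w.cylinder) :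
    D.PathSpace :=
  ⟨fun i => if hi : i < n then u.edge ⟨i, hi⟩ else p.1.1 i, by
    intro i
    by_cases hi : i < n
    · by_cases hi' : i + 1 < n
      · simp only [hi, hi', dif_pos]
        exact (u.tgt_edge ⟨i, hi⟩).trans (u.src_edge ⟨i + 1, hi'⟩).symm
      · obtain rfl : n = i + 1 := by omega
        simp only [hi, hi', dif_pos, dif_neg, not_false_eq_true]
        rw [FinPath.src_of_mem_cylinder p.2, h]
        exact u.tgt_edge (Fin.last i)
    · have hi' : ¬ i + 1 < n := by omega
      simp only [hi, hi', dif_neg, not_false_eq_true]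
      exact p.1.2 i⟩

/-- `F` restricted to `wΩ` is equal to `T_{w, u}`. -/
def RestrictsToTailMap (F : D.PathSpace → D.PathSpace) {n : ℕ} (w u : D.FinPath n) : Prop :=
  ∃ h : w.endpoint = u.endpoint, ∀ p : w.cylinder, F p = tailMap w u h p

/-- The germ `(F, p)` belongs to the tail equivalence groupoid, i.e. it is the germ at `p` of a
transformation of the form `T_{w, u}`. (Compositions of such transformations are again
transformations of this form or empty.) -/
def GermInTail (F : D.PathSpace → D.PathSpace) (p : D.PathSpace) : Prop :=
  ∃ (n : ℕ) (w u : D.FinPath n) (h : w.endpoint = u.endpoint),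
    p ∈ w.cylinder ∧ ∀ᶠ q in 𝓝 p, ∃ hq : q ∈ w.cylinder, F q = tailMap w u h ⟨q, hq⟩

/-- `α_v(F)`: the number of finite paths `w` ending in `v` such that the restriction of `F` to `wΩ`
is not of the form `T_{w, u}` for a path `u` ending in `v`. -/
noncomputable def alpha (F : D.PathSpace → D.PathSpace) {n : ℕ} (v : D.V n) : ℕ∞ :=
  {w : D.FinPath n | w.endpoint = v ∧
    ¬ ∃ u : D.FinPath n, u.endpoint = v ∧ RestrictsToTailMap F w u}.encard

/-- Homeomorphisms of bounded type. -/
def IsBoundedType (F : D.PathSpace ≃ₜ D.PathSpace) : Prop :=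
  (∃ C : ℕ, ∀ (n : ℕ) (v : D.V n), alpha F v ≤ C) ∧
    {p : D.PathSpace | ¬ GermInTail F p}.Finite

end BratteliDiagram

/-!
Call an element `g` of `G` singular at `x` if its germ at `x` is not a tail germ; every `g` has a
finite set `Σ(g)` of singular points. The proof builds an invariant mean on `G` by integrating
means on `G` that are invariant under small subgroups only.

For a finite set `A` of infinite paths, the elements that permute `A` and have `Σ(g) ⊆ A` form a
subgroup `tailStabilizer G A`. It is amenable: its action on `A` and its germs at the points of `A`
define homomorphisms to a finite group and then, one point after the other, to the isotropy groups,
and what remains in the kernel are elements with tail germs only, which form a locally finite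
group by compactness of the path space (`exists_mean_invariant_of_mem_tailStabilizer`).

The arrows `A → g A` with `Σ(g) ⊆ A` form a groupoid whose isotropy groups are the groups
`tailStabilizer G A`. Hence there are means `μ_A` on `G` with `g μ_A = μ_{g A}` whenever
`Σ(g) ⊆ A`. If `m` is a `G`-invariant mean on the finite sets of paths that is concentrated on the
sets containing any given finite set, such as `Σ(g)`, then the integral of `μ_A` with respect to `m`
is invariant under `G` (`exists_invariant_mean_of_subgroupoid`).

The mean `m` exists because the action is recurrent. Fix finitely many group elements and a finite
set `P` of paths that contains the images of their singular points. The finite sets of paths that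
coincide with an element of `P` from level `n` on increase with `n`, and by the bound on `α_v` their
boundaries have bounded size. Averaging the indicator functions of `N` members of this sequence with
disjoint boundaries gives a function of energy `O(1 / N)` that equals `1` on `P`
(`exists_small_energy`). Such a function `a` defines a random finite set, which contains each `x`
independently with probability `sin² (π a(x) / 2)`; its distribution is almost invariant, since the
Hellinger affinity of two product measures of this kind is a product of cosines
(`exists_invariant_mean_finset`).
-/

/-! ### Means -/

/-- Boundedness of a real function on a set. -/
def BddFun {X : Type*} (f : X → ℝ) : Prop := ∃ C, ∀ x, |f x| ≤ C

namespace BddFun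

variable {X Y : Type*} {f g : X → ℝ}

theorem const (c : ℝ) : BddFun (fun _ : X => c) := ⟨|c|, fun _ => le_rfl⟩

theorem add (hf : BddFun f) (hg : BddFun g) : BddFun (fun x => f x + g x) := by
  obtain ⟨C, hC⟩ := hf
  obtain ⟨C', hC'⟩ := hg
  exact ⟨C + C', fun x => (abs_add_le _ _).trans (add_le_add (hC x) (hC' x))⟩

theorem const_mul (c : ℝ) (hf : BddFun f) : BddFun (fun x => c * f x) := by
  obtain ⟨C, hC⟩ := hf
  exact ⟨|c| * C, fun x => by
    rw [abs_mul]; exact mul_le_mul_of_nonneg_left (hC x) (abs_nonneg c)⟩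

theorem comp (hf : BddFun f) (φ : Y → X) : BddFun (fun y => f (φ y)) := by
  obtain ⟨C, hC⟩ := hf
  exact ⟨C, fun y => hC (φ y)⟩

theorem sum {ι : Type*} (s : Finset ι) {F : ι → X → ℝ} (hF : ∀ i, BddFun (F i)) :
    BddFun (fun x => ∑ i ∈ s, F i x) := by
  choose C hC using hF
  exact ⟨∑ i ∈ s, C i, fun x =>
    (Finset.abs_sum_le_sum_abs _ _).trans (Finset.sum_le_sum fun i _ => hC i x)⟩

theorem indicator (A : Set X) : BddFun (A.indicator (fun _ => (1 : ℝ))) := by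
  refine ⟨1, fun x => ?_⟩
  by_cases hx : x ∈ A <;> simp [hx]

end BddFun

/-- A mean on a set `X`: a normalized positive linear functional on the bounded functions on `X`.
It is encoded as a functional on all functions about which nothing is required on unbounded
ones. -/
structure Mean (X : Type*) where
  toFun : (X → ℝ) → ℝ
  map_one : toFun (fun _ => 1) = 1
  map_add : ∀ {f g : X → ℝ}, BddFun f → BddFun g → toFun (fun x => f x + g x) = toFun f + toFun g
  map_const_mul : ∀ (c : ℝ) {f : X → ℝ}, BddFun f → toFun (fun x => c * f x) = c * toFun f
  nonneg : ∀ {f : X → ℝ}, BddFun f → (∀ x, 0 ≤ f x) → 0 ≤ toFun f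

namespace Mean

variable {X Y ι : Type*}

instance : CoeFun (Mean X) (fun _ => (X → ℝ) → ℝ) := ⟨toFun⟩

theorem mono (M : Mean X) {f g : X → ℝ} (hf : BddFun f) (hg : BddFun g) (h : ∀ x, f x ≤ g x) :
    M f ≤ M g := by
  have h1 := M.nonneg (hg.add (hf.const_mul (-1))) fun x => by linarith [h x]
  rw [M.map_add hg (hf.const_mul _), M.map_const_mul _ hf] at h1
  linarith

theorem map_const (M : Mean X) (c : ℝ) : M (fun _ => c) = c := by
  simpa [M.map_one] using M.map_const_mul c (BddFun.const (X := X) 1)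

theorem abs_le (M : Mean X) {f : X → ℝ} {C : ℝ} (h : ∀ x, |f x| ≤ C) : |M f| ≤ C := by
  have hf : BddFun f := ⟨C, h⟩
  refine _root_.abs_le.2 ⟨?_, ?_⟩
  · rw [← M.map_const (-C)]
    exact M.mono (.const _) hf fun x => (_root_.abs_le.1 (h x)).1
  · rw [← M.map_const C]
    exact M.mono hf (.const _) fun x => (_root_.abs_le.1 (h x)).2

theorem abs_sub_le (M : Mean X) {f g : X → ℝ} (hf : BddFun f) (hg : BddFun g) {C : ℝ}
    (h : ∀ x, |f x - g x| ≤ C) : |M f - M g| ≤ C := by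
  have h1 : M (fun x => f x + -1 * g x) = M f - M g := by
    rw [M.map_add hf (hg.const_mul _), M.map_const_mul _ hg]; ring
  rw [← h1]
  exact M.abs_le fun x => by convert h x using 2; ring

theorem map_sum (M : Mean X) (s : Finset ι) {F : ι → X → ℝ} (hF : ∀ i, BddFun (F i)) :
    M (fun x => ∑ i ∈ s, F i x) = ∑ i ∈ s, M (F i) := by
  classical
  induction s using Finset.induction_on with
  | empty => simpa using M.map_const 0
  | insert a s ha ih =>
    simp only [Finset.sum_insert ha]
    rw [M.map_add (hF a) (.sum s hF), ih]

/-- A mean is determined by its values on sets, because bounded functions are uniform limits of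
functions with finitely many values. -/
theorem ext_indicator (M M' : Mean X)
    (h : ∀ A : Set X, M (A.indicator fun _ => 1) = M' (A.indicator fun _ => 1))
    {f : X → ℝ} (hf : BddFun f) : M f = M' f := by
  have key : ∀ n : ℕ, 0 < n → |M f - M' f| ≤ 2 * (1 / (n : ℝ)) := by
    intro n hn
    have hn' : (0 : ℝ) < n := by exact_mod_cast hn
    obtain ⟨C, hC⟩ := hf
    have hf : BddFun f := ⟨C, hC⟩
    set s : Finset ℤ := Finset.Icc ⌊n * (-C)⌋ ⌊n * C⌋
    let F : ℤ → X → ℝ := fun k x => ((k : ℝ) / n) * {x | ⌊n * f x⌋ = k}.indicator (fun _ => 1) x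
    have hF : ∀ k, BddFun (F k) := fun k => (BddFun.indicator _).const_mul _
    have hmem : ∀ x, ⌊n * f x⌋ ∈ s := fun x => by
      have := _root_.abs_le.1 (hC x)
      exact Finset.mem_Icc.2 ⟨Int.floor_le_floor (by nlinarith), Int.floor_le_floor (by nlinarith)⟩
    have hsum : ∀ x, ∑ k ∈ s, F k x = (⌊n * f x⌋ : ℝ) / n := fun x => by
      rw [Finset.sum_eq_single_of_mem _ (hmem x)]
      · simp [F]
      · intro k _ hk
        simp [F, Ne.symm hk]
    have happ : ∀ x, |f x - ∑ k ∈ s, F k x| ≤ 1 / n := fun x => by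
      rw [hsum]
      have h1 := Int.floor_le (n * f x)
      have h2 := Int.lt_floor_add_one (n * f x)
      have h3 : f x - (⌊n * f x⌋ : ℝ) / n = (n * f x - ⌊n * f x⌋) / n := by field_simp
      rw [h3, abs_div, abs_of_pos hn', div_le_div_iff_of_pos_right hn', _root_.abs_le]
      constructor <;> linarith
    have hMM : M (fun x => ∑ k ∈ s, F k x) = M' (fun x => ∑ k ∈ s, F k x) := by
      rw [M.map_sum s hF, M'.map_sum s hF]
      refine Finset.sum_congr rfl fun k _ => ?_
      rw [M.map_const_mul _ (.indicator _), M'.map_const_mul _ (.indicator _), h]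
    have h1 := M.abs_sub_le hf (.sum s hF) happ
    have h2 := M'.abs_sub_le hf (.sum s hF) happ
    rw [hMM] at h1
    rw [_root_.abs_le] at *
    constructor <;> linarith [h1.1, h1.2, h2.1, h2.2]
  by_contra hne
  have hpos : 0 < |M f - M' f| := abs_pos.2 (sub_ne_zero.2 hne)
  obtain ⟨n, hn⟩ := exists_nat_one_div_lt (half_pos hpos)
  have := key (n + 1) n.succ_pos
  push_cast at this
  linarith

/-- The convex combination of point masses with weights `w i` at the points `p i`, `i ∈ s`. -/
def ofWeights (s : Finset ι) (w : ι → ℝ) (p : ι → X) (hw : ∀ i ∈ s, 0 ≤ w i)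
    (h1 : ∑ i ∈ s, w i = 1) : Mean X where
  toFun f := ∑ i ∈ s, w i * f (p i)
  map_one := by simpa using h1
  map_add _ _ := by simp only [mul_add, Finset.sum_add_distrib]
  map_const_mul c f _ := by
    rw [Finset.mul_sum]
    exact Finset.sum_congr rfl fun i _ => by ring
  nonneg _ h := Finset.sum_nonneg fun i hi => mul_nonneg (hw i hi) (h _)

/-- The integral of a family of means on `X` against a mean on `Y`. -/
def bind (m : Mean Y) (μ : Y → Mean X) : Mean X where
  toFun f := m (fun y => μ y f)
  map_one := by simp only [map_one]
  map_add := by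
    rintro f g ⟨C, hC⟩ ⟨C', hC'⟩
    simp only [(μ _).map_add ⟨C, hC⟩ ⟨C', hC'⟩]
    exact m.map_add ⟨C, fun y => (μ y).abs_le hC⟩ ⟨C', fun y => (μ y).abs_le hC'⟩
  map_const_mul := by
    rintro c f ⟨C, hC⟩
    simp only [(μ _).map_const_mul c ⟨C, hC⟩]
    exact m.map_const_mul c ⟨C, fun y => (μ y).abs_le hC⟩
  nonneg := by
    rintro f ⟨C, hC⟩ h
    exact m.nonneg ⟨C, fun y => (μ y).abs_le hC⟩ fun y => (μ y).nonneg ⟨C, hC⟩ h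

/-- The image of a mean under a map. -/
def map (φ : Y → X) (m : Mean Y) : Mean X where
  toFun f := m (fun y => f (φ y))
  map_one := m.map_one
  map_add hf hg := m.map_add (hf.comp φ) (hg.comp φ)
  map_const_mul c _ hf := m.map_const_mul c (hf.comp φ)
  nonneg hf h := m.nonneg (hf.comp φ) fun y => h (φ y)

theorem exists_tendsto (U : Ultrafilter ι) (M : ι → Mean X) {f : X → ℝ} (hf : BddFun f) :
    ∃ a, Tendsto (fun i => M i f) U (𝓝 a) := by
  obtain ⟨C, hC⟩ := hf
  obtain ⟨a, -, ha⟩ := (isCompact_Icc (a := -C) (b := C)).ultrafilter_le_nhds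
    (U.map fun i => M i f) (by
      rw [le_principal_iff]
      exact Filter.univ_mem' (s := (fun i => M i f) ⁻¹' Set.Icc (-C) C)
        fun i => _root_.abs_le.1 ((M i).abs_le hC))
  exact ⟨a, ha⟩

/-- The limit of a family of means along an ultrafilter. -/
noncomputable def ulim (U : Ultrafilter ι) (M : ι → Mean X) : Mean X :=
  have key : ∀ {f : X → ℝ}, BddFun f →
      Tendsto (fun i => M i f) U (𝓝 (limUnder (U : Filter ι) fun i => M i f)) :=
    fun hf => tendsto_nhds_limUnder (exists_tendsto U M hf)
  { toFun := fun f => limUnder (U : Filter ι) fun i => M i f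
    map_one := tendsto_nhds_unique (key (.const 1)) (by simp only [map_one]; exact tendsto_const_nhds)
    map_add := fun {f g} hf hg => tendsto_nhds_unique (key (hf.add hg)) (by
      simpa only [(M _).map_add hf hg] using (key hf).add (key hg))
    map_const_mul := fun c {f} hf => tendsto_nhds_unique (key (hf.const_mul c)) (by
      simpa only [(M _).map_const_mul c hf] using (key hf).const_mul c)
    nonneg := fun {f} hf h => ge_of_tendsto' (key hf) fun i => (M i).nonneg hf h }

theorem tendsto_ulim (U : Ultrafilter ι) (M : ι → Mean X) {f : X → ℝ} (hf : BddFun f) :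
    Tendsto (fun i => M i f) U (𝓝 (ulim U M f)) :=
  tendsto_nhds_limUnder (exists_tendsto U M hf)

/-- Invariance of a mean under the action of a group element. -/
def Invariant {G : Type*} [SMul G X] (M : Mean X) (g : G) : Prop :=
  ∀ f : X → ℝ, BddFun f → M (fun x => f (g • x)) = M f

end Mean

/-- A finitely additive set function gives a mean: it is the limit of the means carried by
one point in each atom of a finite algebra of sets. -/
theorem exists_mean_of_finitelyAdditive {X : Type*} (μ : Set X → ℝ)
    (h0 : ∀ A, 0 ≤ μ A) (h1 : μ Set.univ = 1)
    (hadd : ∀ A B, Disjoint A B → μ (A ∪ B) = μ A + μ B) :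
    ∃ M : Mean X, ∀ A : Set X, M (A.indicator fun _ => 1) = μ A := by
  classical
  have hempty : μ ∅ = 0 := by simpa using hadd ∅ ∅ (by simp)
  have : Nonempty X := by
    by_contra hX
    rw [not_nonempty_iff] at hX
    rw [Set.univ_eq_empty_iff.2 hX, hempty] at h1
    exact zero_ne_one h1
  have hfib : ∀ {T : Type _} (c : X → T) (s : Finset T),
      μ (c ⁻¹' s) = ∑ t ∈ s, μ (c ⁻¹' {t}) := by
    intro T c s
    induction s using Finset.induction_on with
    | empty => simpa using hempty
    | insert a s ha ih =>
      rw [Finset.sum_insert ha, ← ih, ← hadd]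
      · congr 1
        ext x
        simp
      · rw [Set.disjoint_left]
        rintro x hx hx'
        rw [Set.mem_preimage, Set.mem_singleton_iff] at hx
        exact ha (by simpa [hx] using hx')
  let c : ∀ 𝒮 : Finset (Set X), X → (𝒮 → Prop) := fun 𝒮 x S => x ∈ S.1
  let M : Finset (Set X) → Mean X := fun 𝒮 =>
    Mean.ofWeights Finset.univ (fun t => μ (c 𝒮 ⁻¹' {t})) (Function.invFun (c 𝒮))
      (fun _ _ => h0 _) (by rw [← hfib]; simpa using h1)
  have hM : ∀ (𝒮 : Finset (Set X)) (A : Set X), A ∈ 𝒮 → M 𝒮 (A.indicator fun _ => 1) = μ A := by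
    intro 𝒮 A hA
    have hA' : c 𝒮 ⁻¹' (Finset.univ.filter fun t : 𝒮 → Prop => t ⟨A, hA⟩ : Finset _) = A := by
      ext x
      simp [c]
    conv_rhs => rw [← hA', hfib, Finset.sum_filter]
    refine Finset.sum_congr rfl fun t _ => ?_
    rcases (c 𝒮 ⁻¹' {t}).eq_empty_or_nonempty with he | ⟨x, hx⟩
    · simp [he, hempty]
    · have hpt : c 𝒮 (Function.invFun (c 𝒮) t) = t := Function.invFun_eq ⟨x, hx⟩
      have hiff : Function.invFun (c 𝒮) t ∈ A ↔ t ⟨A, hA⟩ := by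
        conv_rhs => rw [← hpt]
      by_cases ht : t ⟨A, hA⟩
      · simp [ht, hiff.2 ht]
      · simp [ht, mt hiff.1 ht]
  refine ⟨Mean.ulim (Ultrafilter.of atTop) M, fun A => ?_⟩
  refine tendsto_nhds_unique (Mean.tendsto_ulim _ M (.indicator A)) ?_
  refine tendsto_const_nhds.congr' (Eventually.filter_mono (Ultrafilter.of_le atTop) ?_)
  filter_upwards [eventually_ge_atTop {A}] with 𝒮 h𝒮
  exact (hM 𝒮 A (h𝒮 (Finset.mem_singleton_self A))).symm

theorem IsAmenableAction.exists_invariant_mean {G X : Type*} [Group G] [MulAction G X]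
    (h : IsAmenableAction G X) : ∃ M : Mean X, ∀ g : G, M.Invariant g := by
  obtain ⟨μ, hμ, h1, hadd, hinv⟩ := h
  obtain ⟨M, hM⟩ := exists_mean_of_finitelyAdditive μ (fun A => (hμ A).1) h1 hadd
  refine ⟨M, fun g f hf => ?_⟩
  refine Mean.ext_indicator (M.map (g • ·)) M (fun A => ?_) hf
  change M (fun x => A.indicator (fun _ => 1) (g • x)) = _
  have h2 : (fun x => A.indicator (fun _ => (1 : ℝ)) (g • x)) =
      ((fun x => g⁻¹ • x) '' A).indicator fun _ => 1 := by
    ext x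
    have : g • x ∈ A ↔ x ∈ (fun x => g⁻¹ • x) '' A := by
      constructor
      · exact fun hx => ⟨_, hx, inv_smul_smul g x⟩
      · rintro ⟨y, hy, rfl⟩
        simpa using hy
    by_cases hx : g • x ∈ A
    · rw [Set.indicator_of_mem hx, Set.indicator_of_mem (this.1 hx)]
    · rw [Set.indicator_of_notMem hx, Set.indicator_of_notMem (mt this.2 hx)]
  rw [h2, hM, hM, hinv]

theorem IsAmenableAction.of_invariant_mean {G X : Type*} [Group G] [MulAction G X]
    (M : Mean X) (h : ∀ g : G, M.Invariant g) : IsAmenableAction G X := by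
  refine ⟨fun A => M (A.indicator fun _ => 1), fun A => ⟨?_, ?_⟩, ?_, fun A B hAB => ?_,
    fun g A => ?_⟩
  · exact M.nonneg (.indicator A) fun x => Set.indicator_nonneg (fun _ _ => zero_le_one) x
  · exact (M.mono (.indicator A) (.const 1) fun x =>
      Set.indicator_le_self' (fun _ _ => zero_le_one) x).trans_eq M.map_one
  · simpa using M.map_one
  · simp only [Set.indicator_union_of_disjoint hAB]
    exact M.map_add (.indicator A) (.indicator B)
  · simp only
    rw [← h g _ (.indicator _)]
    congr 1
    ext x
    by_cases hx : x ∈ A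
    · rw [Set.indicator_of_mem hx, Set.indicator_of_mem (Set.mem_image_of_mem _ hx)]
    · rw [Set.indicator_of_notMem hx, Set.indicator_of_notMem]
      rintro ⟨y, hy, hxy⟩
      exact hx (MulAction.injective g hxy ▸ hy)

/-- Let a group `Γ` act on `X` and `Y`, and let `R g y` mean that the arrow `y → g y` of the action
groupoid belongs to a given wide subgroupoid. If `Y` carries an invariant mean for which almost
all arrows of each `g` belong to the subgroupoid, and `X` carries, for every `y`, a mean that is
invariant under the isotropy group of the subgroupoid at `y`, then `X` carries an invariant mean:
transporting the latter means along the arrows of the subgroupoid gives an equivariant family, which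
is integrated against the former mean. -/
theorem exists_invariant_mean_of_subgroupoid {Γ X Y : Type*} [Group Γ] [MulAction Γ X]
    [MulAction Γ Y] (R : Γ → Y → Prop) (R_one : ∀ y, R 1 y)
    (R_mul : ∀ {g h y}, R g y → R h (g • y) → R (h * g) y)
    (R_inv : ∀ {g y}, R g y → R g⁻¹ (g • y))
    (m : Mean Y) (hm : ∀ g : Γ, m.Invariant g)
    (hmR : ∀ (g : Γ) (f f' : Y → ℝ), BddFun f → BddFun f' → (∀ y, R g y → f y = f' y) → m f = m f')
    (hX : ∀ y, ∃ μ : Mean X, ∀ g : Γ, g • y = y → R g y → μ.Invariant g) :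
    ∃ μ : Mean X, ∀ g : Γ, μ.Invariant g := by
  choose μ hμ using hX
  let s : Setoid Y :=
    { r := fun y z => ∃ g : Γ, R g y ∧ g • y = z
      iseqv :=
        { refl := fun y => ⟨1, R_one y, one_smul _ y⟩
          symm := by
            rintro y z ⟨g, hg, rfl⟩
            exact ⟨g⁻¹, R_inv hg, inv_smul_smul g y⟩
          trans := by
            rintro y z w ⟨g, hg, rfl⟩ ⟨h, hh, rfl⟩
            exact ⟨h * g, R_mul hg hh, mul_smul h g y⟩ } }
  let r : Y → Y := fun y => (Quotient.mk s y).out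
  have hr : ∀ y, ∃ g : Γ, R g (r y) ∧ g • r y = y := fun y => Quotient.mk_out (s := s) y
  have hr' : ∀ {g y}, R g y → r (g • y) = r y := fun {g y} hg =>
    congrArg Quotient.out (Quotient.sound (s := s) ⟨g, hg, rfl⟩ : Quotient.mk s y = _).symm
  choose c hc hcy using hr
  let ν : Y → Mean X := fun y => (μ (r y)).map (c y • ·)
  have hν : ∀ {g y}, R g y → ∀ f, BddFun f → ν y (fun x => f (g • x)) = ν (g • y) f := by
    intro g y hg f hf
    -- the loop at the representative `r y` by which the two transports to `g y` differ
    have hk : (c (g • y))⁻¹ • (g • c y • r y) = r y := by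
      rw [hcy, inv_smul_eq_iff, ← hr' hg, hcy]
    have hRk : R ((c (g • y))⁻¹ * (g * c y)) (r y) := by
      refine R_mul (R_mul (hc y) (by rwa [hcy])) ?_
      have h1 := R_inv (hc (g • y))
      rw [hcy] at h1
      rwa [mul_smul, hcy]
    have h2 := hμ (r y) ((c (g • y))⁻¹ * (g * c y)) (by simpa only [mul_smul] using hk) hRk
      (fun x => f (c (g • y) • x)) (hf.comp _)
    simp only [mul_smul, smul_inv_smul] at h2
    change μ (r y) (fun x => f (g • c y • x)) = μ (r (g • y)) fun x => f (c (g • y) • x)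
    rw [h2, hr' hg]
  refine ⟨m.bind ν, fun g f hf => ?_⟩
  obtain ⟨C, hC⟩ := hf
  have hf : BddFun f := ⟨C, hC⟩
  have hb : BddFun fun y => ν y f := ⟨C, fun y => (ν y).abs_le hC⟩
  change m (fun y => ν y fun x => f (g • x)) = m fun y => ν y f
  rw [← hm g _ hb]
  exact hmR g _ _ ⟨C, fun y => (ν y).abs_le fun x => hC _⟩ (hb.comp _) fun y hy => hν hy f hf

/-! ### Random finite subsets -/

section RandomSubset

variable {X : Type*}

open Classical in
/-- The amplitude of a subset `A` of the finite set `S`. Its square is the probability of `A` if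
every `x ∈ S` is chosen independently with probability `sin² (θ x)`. -/
noncomputable def subsetAmplitude (θ : X → ℝ) (S A : Finset X) : ℝ :=
  (∏ x ∈ A, Real.sin (θ x)) * ∏ x ∈ S \ A, Real.cos (θ x)

theorem sum_subsetAmplitude_mul (θ θ' : X → ℝ) (S : Finset X) :
    ∑ A ∈ S.powerset, subsetAmplitude θ S A * subsetAmplitude θ' S A =
      ∏ x ∈ S, Real.cos (θ x - θ' x) := by
  classical
  have h : ∀ x, Real.cos (θ x - θ' x) =
      Real.sin (θ x) * Real.sin (θ' x) + Real.cos (θ x) * Real.cos (θ' x) := fun x => by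
    rw [Real.cos_sub]; ring
  simp only [h]
  rw [Finset.prod_add]
  refine Finset.sum_congr rfl fun A _ => ?_
  rw [subsetAmplitude, subsetAmplitude, Finset.prod_mul_distrib, Finset.prod_mul_distrib]
  convert mul_mul_mul_comm _ _ _ _ using 2

theorem sum_subsetAmplitude_sq (θ : X → ℝ) (S : Finset X) :
    ∑ A ∈ S.powerset, subsetAmplitude θ S A ^ 2 = 1 := by
  simp only [sq, sum_subsetAmplitude_mul, sub_self, Real.cos_zero, Finset.prod_const_one]

/-- The distribution of the random subset of `S` that contains every `x ∈ S` independently with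
probability `sin² (θ x)`. -/
noncomputable def randomSubset (θ : X → ℝ) (S : Finset X) : Mean (Finset X) :=
  Mean.ofWeights S.powerset (fun A => subsetAmplitude θ S A ^ 2) id (fun _ _ => sq_nonneg _)
    (sum_subsetAmplitude_sq θ S)

theorem randomSubset_apply (θ : X → ℝ) (S : Finset X) (f : Finset X → ℝ) :
    randomSubset θ S f = ∑ A ∈ S.powerset, subsetAmplitude θ S A ^ 2 * f A := rfl

theorem randomSubset_eq_of_subset {θ : X → ℝ} {S T : Finset X} (hST : S ⊆ T)
    (hθ : ∀ x, x ∉ S → θ x = 0) (f : Finset X → ℝ) :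
    randomSubset θ S f = randomSubset θ T f := by
  classical
  rw [randomSubset_apply, randomSubset_apply]
  have h : ∀ A ∈ S.powerset,
      subsetAmplitude θ S A ^ 2 * f A = subsetAmplitude θ T A ^ 2 * f A := by
    intro A _
    have h1 : ∏ x ∈ S \ A, Real.cos (θ x) = ∏ x ∈ T \ A, Real.cos (θ x) := by
      refine Finset.prod_subset (Finset.sdiff_subset_sdiff hST subset_rfl) fun x hx hx' => ?_
      have : x ∉ S := fun hxS => hx' (Finset.mem_sdiff.2 ⟨hxS, (Finset.mem_sdiff.1 hx).2⟩)
      rw [hθ x this, Real.cos_zero]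
    unfold subsetAmplitude
    congr 3
  rw [Finset.sum_congr rfl h]
  refine Finset.sum_subset (Finset.powerset_mono.2 hST) fun A _ hA => ?_
  obtain ⟨x, hxA, hxS⟩ := Finset.not_subset.1 (mt Finset.mem_powerset.2 hA)
  rw [subsetAmplitude, Finset.prod_eq_zero hxA (by rw [hθ x hxS, Real.sin_zero])]
  simp

theorem one_sub_sum_le_prod_one_sub {ι : Type*} (s : Finset ι) (a : ι → ℝ) (h0 : ∀ i, 0 ≤ a i)
    (h1 : ∀ i, a i ≤ 1) : 1 - ∑ i ∈ s, a i ≤ ∏ i ∈ s, (1 - a i) := by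
  classical
  induction s using Finset.induction_on with
  | empty => simp
  | insert i s hi ih =>
    rw [Finset.sum_insert hi, Finset.prod_insert hi]
    have h2 : ∏ i ∈ s, (1 - a i) ≤ 1 :=
      Finset.prod_le_one (fun i _ => sub_nonneg.2 (h1 i)) fun i _ => by linarith [h0 i]
    nlinarith [h0 i, h1 i]

/-- Two product measures are close in total variation if their angles are close in `ℓ²`: the
Hellinger affinity of the measures is the product of the cosines of the differences of the
angles. -/
theorem abs_randomSubset_sub_le {θ θ' : X → ℝ} (S : Finset X) {f : Finset X → ℝ} {C : ℝ}
    (hf : ∀ A, |f A| ≤ C) (hθ : ∀ x, |θ x - θ' x| ≤ Real.pi / 2) :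
    |randomSubset θ S f - randomSubset θ' S f| ≤
      C * (2 * √(∑ x ∈ S, (θ x - θ' x) ^ 2)) := by
  have hC : 0 ≤ C := (abs_nonneg _).trans (hf ∅)
  set a := subsetAmplitude θ S with ha
  set b := subsetAmplitude θ' S with hb
  set B := ∏ x ∈ S, Real.cos (θ x - θ' x) with hB
  have hcos0 : ∀ x, 0 ≤ Real.cos (θ x - θ' x) := fun x =>
    Real.cos_nonneg_of_mem_Icc (abs_le.1 (hθ x) |> fun h => ⟨by linarith [h.1], h.2⟩)
  have hB1 : B ≤ 1 := Finset.prod_le_one (fun x _ => hcos0 x) fun x _ => Real.cos_le_one _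
  have hB2 : 1 - (∑ x ∈ S, (θ x - θ' x) ^ 2) / 2 ≤ B := by
    have h1 := one_sub_sum_le_prod_one_sub S (fun x => 1 - Real.cos (θ x - θ' x))
      (fun x => by linarith [Real.cos_le_one (θ x - θ' x)]) (fun x => by linarith [hcos0 x])
    simp only [sub_sub_cancel] at h1
    refine le_trans ?_ h1
    rw [Finset.sum_div]
    refine sub_le_sub_left (Finset.sum_le_sum fun x _ => ?_) 1
    linarith [Real.one_sub_sq_div_two_le_cos (x := θ x - θ' x)]
  have haa : ∑ A ∈ S.powerset, a A ^ 2 = 1 := sum_subsetAmplitude_sq θ S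
  have hbb : ∑ A ∈ S.powerset, b A ^ 2 = 1 := sum_subsetAmplitude_sq θ' S
  have hab : ∑ A ∈ S.powerset, a A * b A = B := sum_subsetAmplitude_mul θ θ' S
  have hsub : ∑ A ∈ S.powerset, |a A - b A| ^ 2 = 2 - 2 * B := by
    simp only [sq_abs, sub_sq, Finset.sum_add_distrib, Finset.sum_sub_distrib, haa, hbb, mul_assoc,
      ← Finset.mul_sum, hab]
    ring
  have hadd : ∑ A ∈ S.powerset, |a A + b A| ^ 2 = 2 + 2 * B := by
    simp only [sq_abs, add_sq, Finset.sum_add_distrib, haa, hbb, mul_assoc, ← Finset.mul_sum, hab]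
    ring
  have hCS := Finset.sum_mul_sq_le_sq_mul_sq S.powerset (fun A => |a A - b A|)
    (fun A => |a A + b A|)
  rw [hsub, hadd] at hCS
  have hTV : ∑ A ∈ S.powerset, |a A - b A| * |a A + b A| ≤
      2 * √(∑ x ∈ S, (θ x - θ' x) ^ 2) := by
    refine le_of_sq_le_sq ?_ (by positivity)
    rw [mul_pow, Real.sq_sqrt (Finset.sum_nonneg fun _ _ => sq_nonneg _)]
    nlinarith
  rw [randomSubset_apply, randomSubset_apply, ← Finset.sum_sub_distrib]
  refine (Finset.abs_sum_le_sum_abs _ _).trans ?_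
  refine le_trans ?_ (mul_le_mul_of_nonneg_left hTV hC)
  rw [Finset.mul_sum]
  refine Finset.sum_le_sum fun A _ => ?_
  have : a A ^ 2 * f A - b A ^ 2 * f A = f A * ((a A - b A) * (a A + b A)) := by ring
  rw [this, abs_mul, abs_mul]
  exact mul_le_mul_of_nonneg_right (hf A) (by positivity)

open scoped Pointwise Classical in
theorem randomSubset_smul {G : Type*} [Group G] [MulAction G X] (g : G) (θ : X → ℝ) (S : Finset X)
    (f : Finset X → ℝ) :
    randomSubset θ S (fun A => f (g • A)) =
      randomSubset (fun x => θ (g⁻¹ • x)) (g • S) f := by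
  rw [randomSubset_apply, randomSubset_apply]
  have hprod : ∀ (A : Finset X) (F : X → ℝ), ∏ x ∈ g • A, F (g⁻¹ • x) = ∏ x ∈ A, F x := by
    intro A F
    rw [Finset.smul_finset_def, Finset.prod_image (MulAction.injective g).injOn]
    simp
  refine Finset.sum_bij' (fun A _ => g • A) (fun A _ => g⁻¹ • A) ?_ ?_ ?_ ?_ ?_
  · intro A hA
    exact Finset.mem_powerset.2 (Finset.smul_finset_subset_smul_finset (Finset.mem_powerset.1 hA))
  · intro A hA
    rw [Finset.mem_powerset] at hA ⊢
    rw [← inv_smul_smul g S]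
    exact Finset.smul_finset_subset_smul_finset hA
  · intro A _
    exact inv_smul_smul g A
  · intro A _
    exact smul_inv_smul g A
  · intro A _
    unfold subsetAmplitude
    rw [← Finset.smul_finset_sdiff, hprod A fun x => Real.sin (θ x),
      hprod (S \ A) fun x => Real.cos (θ x)]

open scoped Pointwise Classical in
/-- Finitely supported functions of arbitrarily small energy that are equal to `π / 2` on any given
finite set yield an invariant mean on the finite subsets of `X` that is concentrated on the sets
containing any given finite set: a point with angle `π / 2` belongs to the random subset almost
surely. -/
theorem exists_invariant_mean_finset {G : Type*} [Group G] [MulAction G X]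
    (h : ∀ (K : Finset G) (F : Finset X) (ε : ℝ), 0 < ε → ∃ (θ : X → ℝ) (S : Finset X),
      (∀ x, θ x ∈ Set.Icc 0 (Real.pi / 2)) ∧ (∀ x, x ∉ S → θ x = 0) ∧
      (∀ x ∈ F, θ x = Real.pi / 2) ∧
      ∀ g ∈ K, ∀ T : Finset X, ∑ x ∈ T, (θ x - θ (g • x)) ^ 2 ≤ ε) :
    ∃ m : Mean (Finset X), (∀ g : G, m.Invariant g) ∧
      ∀ (F : Finset X) (f f' : Finset X → ℝ), BddFun f → BddFun f' →
        (∀ A, F ⊆ A → f A = f' A) → m f = m f' := by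
  choose θ S hθI hθS hθF hθK using fun i : Finset G × Finset X × ℕ =>
    h i.1 i.2.1 (1 / (i.2.2 + 1)) Nat.one_div_pos_of_nat
  let U : Ultrafilter (Finset G × Finset X × ℕ) := Ultrafilter.of atTop
  let M : Finset G × Finset X × ℕ → Mean (Finset X) := fun i => randomSubset (θ i) (S i)
  have hU : (U : Filter (Finset G × Finset X × ℕ)) ≤ atTop := Ultrafilter.of_le atTop
  refine ⟨Mean.ulim U M, fun g f hf => ?_, fun F f f' hf hf' hff' => ?_⟩
  · obtain ⟨C, hC⟩ := hf
    have hf : BddFun f := ⟨C, hC⟩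
    have hlim : Tendsto (fun i : Finset G × Finset X × ℕ => C * (2 * √(1 / ((i.2.2 : ℝ) + 1))))
        U (𝓝 0) := by
      have h1 : Tendsto (fun n : ℕ => C * (2 * √(1 / ((n : ℝ) + 1)))) atTop (𝓝 0) := by
        have := (tendsto_one_div_add_atTop_nhds_zero_nat (𝕜 := ℝ)).sqrt
        simpa using (this.const_mul 2).const_mul C
      refine h1.comp (Tendsto.mono_left ?_ hU)
      rw [← prod_atTop_atTop_eq, ← prod_atTop_atTop_eq]
      exact tendsto_snd.comp tendsto_snd
    have hdiff : Tendsto (fun i => M i (fun A => f (g • A)) - M i f) U (𝓝 0) := by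
      refine squeeze_zero_norm' (hU ?_) hlim
      filter_upwards [eventually_ge_atTop (({g⁻¹}, ∅, 0) : Finset G × Finset X × ℕ)] with i hi
      have hC0 : 0 ≤ C := (abs_nonneg _).trans (hC ∅)
      have h1 : M i (fun A => f (g • A)) =
          randomSubset (fun x => θ i (g⁻¹ • x)) (S i ∪ g • S i) f := by
        rw [← randomSubset_eq_of_subset Finset.subset_union_right]
        · exact randomSubset_smul g (θ i) (S i) f
        · intro x hx
          exact hθS i _ fun hx' => hx (Finset.mem_smul_finset.2 ⟨_, hx', smul_inv_smul g x⟩)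
      have h2 : M i f = randomSubset (θ i) (S i ∪ g • S i) f :=
        randomSubset_eq_of_subset Finset.subset_union_left (hθS i) f
      rw [h1, h2, Real.norm_eq_abs, abs_sub_comm]
      refine (abs_randomSubset_sub_le _ hC fun x => ?_).trans ?_
      · have h3 := hθI i x
        have h4 := hθI i (g⁻¹ • x)
        rw [abs_le]
        constructor <;> linarith [h3.1, h3.2, h4.1, h4.2]
      · gcongr
        exact hθK i g⁻¹ (hi.1 (Finset.mem_singleton_self _)) _
    refine tendsto_nhds_unique (Mean.tendsto_ulim U M (hf.comp _)) ?_
    simpa using hdiff.add (Mean.tendsto_ulim U M hf)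
  · refine tendsto_nhds_unique_of_eventuallyEq (Mean.tendsto_ulim U M hf)
      (Mean.tendsto_ulim U M hf') (hU ?_)
    filter_upwards [eventually_ge_atTop ((∅, F, 0) : Finset G × Finset X × ℕ)] with i hi
    change randomSubset _ _ _ = randomSubset _ _ _
    rw [randomSubset_apply, randomSubset_apply]
    refine Finset.sum_congr rfl fun A _ => ?_
    by_cases hFA : F ⊆ A
    · rw [hff' A hFA]
    · obtain ⟨x, hxF, hxA⟩ := Finset.not_subset.1 hFA
      have hx : θ i x = Real.pi / 2 := hθF i x (hi.2.1 hxF)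
      have hxS : x ∈ S i := by
        by_contra hxS
        rw [hθS i x hxS] at hx
        linarith [Real.pi_pos]
      have h0 : subsetAmplitude (θ i) (S i) A = 0 := by
        rw [subsetAmplitude, Finset.prod_eq_zero (i := x) (s := S i \ A)
          (Finset.mem_sdiff.2 ⟨hxS, hxA⟩) (by rw [hx, Real.cos_pi_div_two]), mul_zero]
      simp [h0]

end RandomSubset

/-! ### Exhaustions with bounded boundaries -/

/-- The boundary, with respect to a group element `g`, of a set `T`. -/
def smulBoundary {G X : Type*} [SMul G X] (g : G) (T : Set X) : Set X :=
  {x | ¬ (x ∈ T ↔ g • x ∈ T)}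

/-- If an increasing sequence of finite sets has boundaries of bounded size, and every boundary edge
lies inside a later member, then a sparse subsequence has disjoint boundaries, and the averages of
the indicator functions of its first `N` members have energy `O(1 / N)`. -/
theorem exists_small_energy {G X : Type*} [SMul G X] (K : Finset G) (T : ℕ → Set X)
    (hT : Monotone T) (hfin : ∀ n, (T n).Finite) (C : ℕ)
    (hC : ∀ g ∈ K, ∀ n, (smulBoundary g (T n)).encard ≤ C)
    (hswallow : ∀ g ∈ K, ∀ n, ∀ x ∈ smulBoundary g (T n), ∃ m, x ∈ T m ∧ g • x ∈ T m)
    (F : Finset X) (hF : ∀ x ∈ F, x ∈ T 0) (ε : ℝ) (hε : 0 < ε) :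
    ∃ (θ : X → ℝ) (S : Finset X),
      (∀ x, θ x ∈ Set.Icc 0 (Real.pi / 2)) ∧ (∀ x, x ∉ S → θ x = 0) ∧
      (∀ x ∈ F, θ x = Real.pi / 2) ∧
      ∀ g ∈ K, ∀ T : Finset X, ∑ x ∈ T, (θ x - θ (g • x)) ^ 2 ≤ ε := by
  classical
  have hbfin : ∀ g ∈ K, ∀ n, (smulBoundary g (T n)).Finite := fun g hg n =>
    Set.finite_of_encard_le_coe (hC g hg n)
  -- a later member of the sequence contains both ends of every boundary edge
  have hnext : ∀ n, ∃ m, n ≤ m ∧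
      ∀ g ∈ K, ∀ x ∈ smulBoundary g (T n), x ∈ T m ∧ g • x ∈ T m := by
    intro n
    have h1 : ∀ᶠ m in atTop, ∀ g ∈ K, ∀ x ∈ smulBoundary g (T n), x ∈ T m ∧ g • x ∈ T m := by
      refine (Filter.eventually_all_finset K).2 fun g hg => ?_
      refine (Filter.eventually_all_finite (hbfin g hg n)).2 fun x hx => ?_
      obtain ⟨m, hm⟩ := hswallow g hg n x hx
      filter_upwards [eventually_ge_atTop m] with m' hm'
      exact ⟨hT hm' hm.1, hT hm' hm.2⟩
    exact ((eventually_ge_atTop n).and h1).exists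
  choose next hnext_le hnext using hnext
  let k : ℕ → ℕ := fun j => next^[j] 0
  have hk_succ : ∀ j, k (j + 1) = next (k j) := fun j => Function.iterate_succ_apply' next j 0
  have hk : Monotone k := monotone_nat_of_le_succ fun j => by
    rw [hk_succ]; exact hnext_le _
  have hkT : ∀ g ∈ K, ∀ i j, i < j → ∀ x ∈ smulBoundary g (T (k i)),
      x ∉ smulBoundary g (T (k j)) := by
    intro g hg i j hij x hx hx'
    have h1 := hnext (k i) g hg x hx
    rw [← hk_succ] at h1
    have h2 := hT (hk (Nat.succ_le_of_lt hij))
    exact hx' ⟨fun _ => h2 h1.2, fun _ => h2 h1.1⟩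
  obtain ⟨N, hN⟩ := exists_nat_gt ((Real.pi / 2) ^ 2 * C / ε)
  have hN0 : (0 : ℝ) < N := lt_of_le_of_lt (by positivity) hN
  let I : ℕ → X → ℝ := fun j => (T (k j)).indicator fun _ => 1
  have hI0 : ∀ j x, 0 ≤ I j x := fun j x => Set.indicator_nonneg (fun _ _ => zero_le_one) x
  have hI1 : ∀ j x, I j x ≤ 1 := fun j x => Set.indicator_le_self' (fun _ _ => zero_le_one) x
  let θ : X → ℝ := fun x => Real.pi / 2 / N * ∑ j ∈ Finset.range N, I j x
  refine ⟨θ, (hfin (k N)).toFinset, fun x => ⟨?_, ?_⟩, fun x hx => ?_, fun x hx => ?_,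
    fun g hg V => ?_⟩
  · exact mul_nonneg (by positivity) (Finset.sum_nonneg fun j _ => hI0 j x)
  · calc θ x ≤ Real.pi / 2 / N * N := by
          refine mul_le_mul_of_nonneg_left ?_ (by positivity)
          simpa using Finset.sum_le_sum fun j (_ : j ∈ Finset.range N) => hI1 j x
      _ = Real.pi / 2 := by field_simp
  · have h1 : ∀ j ∈ Finset.range N, I j x = 0 := fun j hj => by
      refine Set.indicator_of_notMem (fun hxj => hx ?_) _
      exact (hfin (k N)).mem_toFinset.2 (hT (hk (Finset.mem_range.1 hj).le) hxj)
    change _ * _ = _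
    rw [Finset.sum_eq_zero h1, mul_zero]
  · have h1 : ∀ j ∈ Finset.range N, I j x = 1 := fun j _ =>
      Set.indicator_of_mem (hT (Nat.zero_le _) (hF x hx)) _
    change _ * _ = _
    rw [Finset.sum_congr rfl h1]
    simp only [Finset.sum_const, Finset.card_range, nsmul_eq_mul, mul_one]
    field_simp
  · have hd : ∀ j x, (I j x - I j (g • x)) * (I j x - I j (g • x)) =
        (smulBoundary g (T (k j))).indicator (fun _ => 1) x := by
      intro j x
      by_cases h1 : x ∈ T (k j) <;> by_cases h2 : g • x ∈ T (k j) <;>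
        simp [I, smulBoundary, h1, h2]
    have hd0 : ∀ j x, x ∉ smulBoundary g (T (k j)) → I j x - I j (g • x) = 0 := by
      intro j x hx
      have := hd j x
      rwa [Set.indicator_of_notMem hx, mul_self_eq_zero] at this
    -- the boundaries are disjoint, so at most one of the differences is nonzero
    have hpt : ∀ x, (θ x - θ (g • x)) ^ 2 = (Real.pi / 2 / N) ^ 2 *
        ∑ j ∈ Finset.range N, (smulBoundary g (T (k j))).indicator (fun _ => 1) x := by
      intro x
      have h1 : θ x - θ (g • x) =
          Real.pi / 2 / N * ∑ j ∈ Finset.range N, (I j x - I j (g • x)) := by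
        rw [Finset.sum_sub_distrib, mul_sub]
      rw [h1, mul_pow, sq (∑ j ∈ _, _), Finset.sum_mul_sum]
      congr 1
      refine Finset.sum_congr rfl fun i hi => ?_
      rw [Finset.sum_eq_single_of_mem i hi, hd]
      intro j _ hji
      by_cases hx : x ∈ smulBoundary g (T (k i))
      · rw [hd0 j x, mul_zero]
        intro hx'
        rcases lt_or_gt_of_ne hji with hlt | hlt
        · exact hkT g hg j i hlt x hx' hx
        · exact hkT g hg i j hlt x hx hx'
      · rw [hd0 i x hx, zero_mul]
    have hcard : ∀ j, ∑ x ∈ V, (smulBoundary g (T (k j))).indicator (fun _ => (1 : ℝ)) x ≤ C := by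
      intro j
      have hb := hbfin g hg (k j)
      rw [Finset.sum_indicator_eq_sum_filter]
      simp only [Finset.sum_const, nsmul_eq_mul, mul_one, Nat.cast_le]
      have h1 := hC g hg (k j)
      rw [hb.encard_eq_coe_toFinset_card, Nat.cast_le] at h1
      refine le_trans (Finset.card_le_card fun x hx => ?_) h1
      exact hb.mem_toFinset.2 (Finset.mem_filter.1 hx).2
    calc ∑ x ∈ V, (θ x - θ (g • x)) ^ 2
        = (Real.pi / 2 / N) ^ 2 * ∑ j ∈ Finset.range N,
            ∑ x ∈ V, (smulBoundary g (T (k j))).indicator (fun _ => 1) x := by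
          simp only [hpt]
          rw [← Finset.mul_sum, Finset.sum_comm]
      _ ≤ (Real.pi / 2 / N) ^ 2 * (N * C) := by
          refine mul_le_mul_of_nonneg_left ?_ (by positivity)
          simpa using Finset.sum_le_sum fun j (_ : j ∈ Finset.range N) => hcard j
      _ = (Real.pi / 2) ^ 2 * C / N := by field_simp
      _ ≤ ε := by
          rw [div_le_iff₀ hN0]
          rw [div_lt_iff₀ hε] at hN
          linarith

/-! ### Tail germs and bounded type -/

namespace BratteliDiagram

variable {D : BratteliDiagram}

instance (n : ℕ) : Finite (∀ i : Fin n, D.E i) :=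
  have := D.finite_E
  inferInstance

/-- The first `n` edges of an infinite path. -/
def pathPrefix (n : ℕ) (p : D.PathSpace) : ∀ i : Fin n, D.E i := fun i => p.1 i

theorem pathPrefix_eq_iff {n : ℕ} {p q : D.PathSpace} :
    pathPrefix n p = pathPrefix n q ↔ ∀ i < n, p.1 i = q.1 i :=
  ⟨fun h i hi => congrFun h ⟨i, hi⟩, fun h => funext fun i => h i i.2⟩

theorem PathSpace.ext_of_pathPrefix {n : ℕ} {p q : D.PathSpace} (h : pathPrefix n p = pathPrefix n q)
    (h' : ∀ i ≥ n, p.1 i = q.1 i) : p = q :=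
  Subtype.ext <| funext fun i =>
    (lt_or_ge i n).elim (pathPrefix_eq_iff.1 h i) (h' i)

/-- The infinite paths with given first `n` edges form a neighbourhood. -/
theorem eventually_pathPrefix_eq (n : ℕ) (p : D.PathSpace) :
    ∀ᶠ q in 𝓝 p, pathPrefix n q = pathPrefix n p := by
  let _ : ∀ i, TopologicalSpace (D.E i) := fun _ => ⊥
  have : ∀ i, DiscreteTopology (D.E i) := fun _ => ⟨rfl⟩
  have hc : Continuous (fun p : D.PathSpace => (p.1 : ∀ i, D.E i)) := continuous_induced_dom
  have h : ∀ᶠ q in 𝓝 p, ∀ i ∈ Set.Iio n, q.1 i = p.1 i := by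
    refine (Filter.eventually_all_finite (Set.finite_Iio n)).2 fun i _ => ?_
    exact ((continuous_apply i).comp hc).continuousAt.eventually
      (IsOpen.mem_nhds (isOpen_discrete {p.1 i}) rfl)
  exact h.mono fun q hq => pathPrefix_eq_iff.2 hq

theorem exists_pathPrefix_of_eventually {p : D.PathSpace} {P : D.PathSpace → Prop}
    (h : ∀ᶠ q in 𝓝 p, P q) : ∃ n, ∀ q, pathPrefix n q = pathPrefix n p → P q := by
  let _ : ∀ i, TopologicalSpace (D.E i) := fun _ => ⊥
  have : ∀ i, DiscreteTopology (D.E i) := fun _ => ⟨rfl⟩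
  rw [nhds_induced, eventually_comap, nhds_pi, Filter.eventually_iff, Filter.mem_pi] at h
  obtain ⟨I, hI, t, ht, hsub⟩ := h
  obtain ⟨n, hn⟩ := hI.bddAbove
  refine ⟨n + 1, fun q hq => hsub (fun i hi => ?_) q rfl⟩
  rw [pathPrefix_eq_iff.1 hq i (Nat.lt_succ_of_le (hn hi))]
  exact mem_of_mem_nhds (ht i)

instance : CompactSpace D.PathSpace := by
  let _ : ∀ i, TopologicalSpace (D.E i) := fun _ => ⊥
  have : ∀ i, DiscreteTopology (D.E i) := fun _ => ⟨rfl⟩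
  have := D.finite_E
  have hemb : IsClosedEmbedding (fun p : D.PathSpace => (p.1 : ∀ i, D.E i)) := by
    refine ⟨⟨⟨rfl⟩, Subtype.val_injective⟩, ?_⟩
    have hr : Set.range (fun p : D.PathSpace => (p.1 : ∀ i, D.E i)) =
        ⋂ i, {e | D.tgt (e i) = D.src (e (i + 1))} := by
      ext e
      simp only [Set.mem_range, Set.mem_iInter, Set.mem_ofPred_eq]
      exact ⟨by rintro ⟨p, rfl⟩; exact p.2, fun h => ⟨⟨e, h⟩, rfl⟩⟩
    rw [hr]
    refine isClosed_iInter fun i => ?_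
    have hc : Continuous fun e : ∀ i, D.E i => (e i, e (i + 1)) := by fun_prop
    exact (isClosed_discrete {x : D.E i × D.E (i + 1) | D.tgt x.1 = D.src x.2}).preimage hc
  exact hemb.compactSpace

/-- On the paths that have the first `n` edges in common with `p`, the map `F` replaces these edges
by other ones and changes nothing else. -/
def IsTailOn (F : D.PathSpace → D.PathSpace) (n : ℕ) (p : D.PathSpace) : Prop :=
  ∀ q, pathPrefix n q = pathPrefix n p →
    pathPrefix n (F q) = pathPrefix n (F p) ∧ ∀ i ≥ n, (F q).1 i = q.1 i

theorem IsTailOn.congr {F : D.PathSpace → D.PathSpace} {n : ℕ} {p p' : D.PathSpace}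
    (h : IsTailOn F n p) (hp : pathPrefix n p' = pathPrefix n p) : IsTailOn F n p' := fun q hq =>
  ⟨(h q (hq.trans hp)).1.trans (h p' hp).1.symm, (h q (hq.trans hp)).2⟩

theorem pathPrefix_eq_of_le {m n : ℕ} (hmn : m ≤ n) {p q : D.PathSpace}
    (h : pathPrefix n p = pathPrefix n q) : pathPrefix m p = pathPrefix m q :=
  pathPrefix_eq_iff.2 fun i hi => pathPrefix_eq_iff.1 h i (hi.trans_le hmn)

theorem IsTailOn.mono {F : D.PathSpace → D.PathSpace} {m n : ℕ} (hmn : m ≤ n) {p : D.PathSpace}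
    (h : IsTailOn F m p) : IsTailOn F n p := by
  intro q hq
  have h1 := h q (pathPrefix_eq_of_le hmn hq)
  refine ⟨pathPrefix_eq_iff.2 fun i hi => ?_, fun i hi => h1.2 i (hmn.trans hi)⟩
  rcases lt_or_ge i m with him | him
  · exact pathPrefix_eq_iff.1 h1.1 i him
  · rw [h1.2 i him, (h p rfl).2 i him]
    exact pathPrefix_eq_iff.1 hq i hi

theorem IsTailOn.comp {F F' : D.PathSpace → D.PathSpace} {n : ℕ} {p : D.PathSpace}
    (h : IsTailOn F n p) (h' : IsTailOn F' n (F p)) : IsTailOn (F' ∘ F) n p := fun q hq =>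
  ⟨(h' _ (h q hq).1).1, fun i hi => ((h' _ (h q hq).1).2 i hi).trans ((h q hq).2 i hi)⟩

/-- The germ of `F` at `p` belongs to the tail equivalence groupoid, in terms of edges. -/
def IsTailAt (F : D.PathSpace → D.PathSpace) (p : D.PathSpace) : Prop := ∃ n, IsTailOn F n p

theorem GermInTail.isTailAt {F : D.PathSpace → D.PathSpace} {p : D.PathSpace}
    (h : GermInTail F p) : IsTailAt F p := by
  obtain ⟨n, w, u, h, hp, hev⟩ := h
  obtain ⟨m, hm⟩ := exists_pathPrefix_of_eventually hev
  refine ⟨max m n, fun q hq => ?_⟩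
  obtain ⟨_, hFq⟩ := hm q (pathPrefix_eq_of_le (le_max_left _ _) hq)
  obtain ⟨_, hFp⟩ := hm p rfl
  have hlt : ∀ i (hi : i < n), (F q).1 i = u.edge ⟨i, hi⟩ ∧ (F p).1 i = u.edge ⟨i, hi⟩ := by
    intro i hi
    rw [hFq, hFp]
    simp [tailMap, hi]
  have hge : ∀ i, n ≤ i → (F q).1 i = q.1 i ∧ (F p).1 i = p.1 i := by
    intro i hi
    rw [hFq, hFp]
    simp [tailMap, hi.not_gt]
  refine ⟨pathPrefix_eq_iff.2 fun i hi => ?_, fun i hi => (hge i (le_of_max_le_right hi)).1⟩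
  rcases lt_or_ge i n with hin | hin
  · rw [(hlt i hin).1, (hlt i hin).2]
  · rw [(hge i hin).1, (hge i hin).2]
    exact pathPrefix_eq_iff.1 hq i hi

theorem IsTailAt.comp {F F' : D.PathSpace → D.PathSpace} {p : D.PathSpace}
    (h : IsTailAt F p) (h' : IsTailAt F' (F p)) : IsTailAt (F' ∘ F) p := by
  obtain ⟨m, hm⟩ := h
  obtain ⟨n, hn⟩ := h'
  exact ⟨max m n, (hm.mono (le_max_left _ _)).comp (hn.mono (le_max_right _ _))⟩

theorem isTailAt_of_eventually_eq {F : D.PathSpace → D.PathSpace} {p : D.PathSpace}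
    (h : ∀ᶠ q in 𝓝 p, F q = q) : IsTailAt F p := by
  obtain ⟨n, hn⟩ := exists_pathPrefix_of_eventually h
  exact ⟨n, fun q hq => ⟨by rw [hn q hq, hn p rfl, hq], fun i _ => by rw [hn q hq]⟩⟩

/-- If all germs of `F` are tail germs, then by compactness `F` changes only the first `n` edges,
uniformly over all paths. -/
theorem exists_forall_isTailOn {F : D.PathSpace → D.PathSpace} (h : ∀ p, IsTailAt F p) :
    ∃ n, ∀ p, IsTailOn F n p := by
  choose n hn using h
  obtain ⟨t, ht⟩ := CompactSpace.elim_nhds_subcover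
    (fun p => {q | pathPrefix (n p) q = pathPrefix (n p) p}) fun p => eventually_pathPrefix_eq (n p) p
  refine ⟨t.sup n, fun p => ?_⟩
  have hp : p ∈ (⊤ : Set D.PathSpace) := trivial
  rw [← ht] at hp
  obtain ⟨q, hq, hpq⟩ := Set.mem_iUnion₂.1 hp
  exact ((hn q).congr hpq).mono (Finset.le_sup hq)

/-- The first `n` edges of an infinite path, as a finite path. -/
def toFinPath (n : ℕ) (p : D.PathSpace) : D.FinPath n where
  vert i := D.src (p.1 i)
  edge i := p.1 i
  src_edge _ := rfl
  tgt_edge i := p.2 i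

theorem mem_cylinder_toFinPath (n : ℕ) (p : D.PathSpace) : p ∈ (toFinPath n p).cylinder :=
  ⟨rfl, fun _ => rfl⟩

/-- The infinite paths that coincide from level `n` on with one of the given paths. -/
def cotail (P : Set D.PathSpace) (n : ℕ) : Set D.PathSpace :=
  {x | ∃ p ∈ P, ∀ i ≥ n, x.1 i = p.1 i}

theorem cotail_mono (P : Set D.PathSpace) : Monotone (cotail P) := by
  rintro m n hmn x ⟨p, hp, h⟩
  exact ⟨p, hp, fun i hi => h i (hmn.trans hi)⟩

theorem subset_cotail (P : Set D.PathSpace) (n : ℕ) : P ⊆ cotail P n :=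
  fun p hp => ⟨p, hp, fun _ _ => rfl⟩

theorem finite_cotail {P : Set D.PathSpace} (hP : P.Finite) (n : ℕ) : (cotail P n).Finite := by
  have h : cotail P n = ⋃ p ∈ P, {x | ∀ i ≥ n, x.1 i = p.1 i} := by
    ext x; simp [cotail]
  rw [h]
  refine hP.biUnion fun p _ => Set.Finite.of_injOn (f := pathPrefix n) (t := Set.univ)
    (fun _ _ => trivial) ?_ Set.finite_univ
  intro x hx y hy hxy
  exact PathSpace.ext_of_pathPrefix hxy fun i hi => (hx i hi).trans (hy i hi).symm

/-- The number `α_v(F)`, `v` the vertex of `p` on level `n`, bounds the number of paths cofinal with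
`p` from level `n` on that `F` maps to paths that are not. -/
theorem encard_cotail_exit_le_alpha (F : D.PathSpace → D.PathSpace) (n : ℕ) (p : D.PathSpace) :
    {x : D.PathSpace | (∀ i ≥ n, x.1 i = p.1 i) ∧ ¬ ∀ i ≥ n, (F x).1 i = p.1 i}.encard ≤
      alpha F (D.src (p.1 n)) := by
  refine Set.encard_le_encard_of_injOn (f := toFinPath n) ?_ ?_
  · rintro x ⟨hx, hFx⟩
    refine ⟨congrArg D.src (hx n le_rfl), ?_⟩
    rintro ⟨u, -, h, hu⟩
    refine hFx fun i hi => ?_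
    rw [hu ⟨x, mem_cylinder_toFinPath n x⟩, ← hx i hi]
    simp [tailMap, hi.not_gt]
  · intro x hx y hy hxy
    have h1 : pathPrefix n x = pathPrefix n y := congrArg FinPath.edge hxy
    exact PathSpace.ext_of_pathPrefix h1 fun i hi => (hx.1 i hi).trans (hy.1 i hi).symm

theorem encard_exit_le {F : D.PathSpace → D.PathSpace} {C : ℕ}
    (hC : ∀ (n : ℕ) (v : D.V n), alpha F v ≤ C) (P : Finset D.PathSpace) (n : ℕ) :
    {x | x ∈ cotail (P : Set D.PathSpace) n ∧ F x ∉ cotail (P : Set D.PathSpace) n}.encard ≤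
      (P.card * C : ℕ) := by
  classical
  have hsub : {x | x ∈ cotail (P : Set D.PathSpace) n ∧ F x ∉ cotail (P : Set D.PathSpace) n} ⊆
      ⋃ p ∈ P, {x : D.PathSpace |
        (∀ i ≥ n, x.1 i = p.1 i) ∧ ¬ ∀ i ≥ n, (F x).1 i = p.1 i} := by
    rintro x ⟨⟨p, hp, hx⟩, hFx⟩
    exact Set.mem_iUnion₂.2 ⟨p, hp, hx, fun h => hFx ⟨p, hp, h⟩⟩
  refine (Set.encard_le_encard hsub).trans ?_
  clear hsub
  induction P using Finset.induction_on with
  | empty => simp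
  | insert a s ha ih =>
    rw [Finset.set_biUnion_insert, Finset.card_insert_of_notMem ha, add_mul, one_mul, add_comm]
    refine (Set.encard_union_le _ _).trans ?_
    push_cast at ih ⊢
    exact add_le_add ((encard_cotail_exit_le_alpha F n a).trans (hC n _)) ih

end BratteliDiagram

/-! ### Groups acting on the path space by homeomorphisms of bounded type -/

section PathSpaceAction

open BratteliDiagram

variable {D : BratteliDiagram} {G : Type*} [Group G] [MulAction G D.PathSpace]

theorem isTailAt_one (p : D.PathSpace) : IsTailAt ((1 : G) • ·) p :=
  isTailAt_of_eventually_eq (Eventually.of_forall fun q => one_smul G q)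

theorem isTailAt_mul {g h : G} {p : D.PathSpace} (hg : IsTailAt (g • ·) p)
    (hh : IsTailAt (h • ·) (g • p)) : IsTailAt ((h * g) • ·) p := by
  have := hg.comp hh
  convert this using 1
  ext q : 1
  exact mul_smul h g q

theorem isTailAt_inv [ContinuousConstSMul G D.PathSpace] {g : G} {p : D.PathSpace}
    (hg : IsTailAt (g • ·) p) : IsTailAt (g⁻¹ • ·) (g • p) := by
  obtain ⟨n, hn⟩ := hg
  have hev : ∀ᶠ q in 𝓝 (g • p), pathPrefix n (g⁻¹ • q) = pathPrefix n p := by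
    have h1 := ((continuous_const_smul g⁻¹).tendsto (g • p)).eventually
      (eventually_pathPrefix_eq n (g⁻¹ • g • p))
    simpa only [inv_smul_smul] using h1
  obtain ⟨m, hm⟩ := exists_pathPrefix_of_eventually hev
  refine ⟨max m n, fun q hq => ?_⟩
  have h1 := hm q (pathPrefix_eq_of_le (le_max_left _ _) hq)
  have h2 := (hn _ h1).2
  have h3 := (hn _ rfl).2
  simp only [smul_inv_smul] at h2
  simp only [inv_smul_smul] at *
  refine ⟨pathPrefix_eq_iff.2 fun i hi => ?_, fun i hi => (h2 i (le_of_max_le_right hi)).symm⟩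
  rcases lt_or_ge i n with hin | hin
  · exact pathPrefix_eq_iff.1 h1 i hin
  · rw [← h2 i hin, ← h3 i hin]
    exact pathPrefix_eq_iff.1 hq i hi

/-- The action of a group of homeomorphisms of bounded type on the finite subsets of the path
space has an invariant mean that is concentrated on the sets containing any given finite set. -/
theorem exists_invariant_mean_finset_pathSpace [ContinuousConstSMul G D.PathSpace]
    (hbounded : ∀ g : G, IsBoundedType (Homeomorph.smul g : D.PathSpace ≃ₜ D.PathSpace)) :
    open scoped Pointwise Classical in
    ∃ m : Mean (Finset D.PathSpace), (∀ g : G, m.Invariant g) ∧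
      ∀ (F : Finset D.PathSpace) (f f' : Finset D.PathSpace → ℝ), BddFun f → BddFun f' →
        (∀ A, F ⊆ A → f A = f' A) → m f = m f' := by
  classical
  choose C hC using fun g => (hbounded g).1
  have hfin : ∀ g : G, {p : D.PathSpace | ¬ IsTailAt (g • ·) p}.Finite := fun g =>
    (hbounded g).2.subset fun p hp h => hp h.isTailAt
  refine exists_invariant_mean_finset fun K F ε hε => ?_
  let K' : Finset G := K ∪ K.image (·⁻¹)
  -- the given points and the images of the singular points: the union of their tail classes
  -- is invariant under the elements of `K`
  let P : Finset D.PathSpace := F ∪ K'.biUnion fun g => (hfin g).toFinset.image (g • ·)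
  have hP : ∀ g ∈ K', ∀ x : D.PathSpace, ¬ IsTailAt (g • ·) x → g • x ∈ P := fun g hg x hx =>
    Finset.mem_union_right _ (Finset.mem_biUnion.2
      ⟨g, hg, Finset.mem_image_of_mem _ ((hfin g).mem_toFinset.2 hx)⟩)
  let T : ℕ → Set D.PathSpace := cotail (P : Set D.PathSpace)
  have hT : Monotone T := cotail_mono _
  have hPT : ∀ n, (P : Set D.PathSpace) ⊆ T n := subset_cotail _
  have hinv : ∀ g ∈ K', ∀ n, ∀ x ∈ T n, ∃ m, x ∈ T m ∧ g • x ∈ T m := by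
    intro g hg n x hx
    by_cases hgx : IsTailAt (g • ·) x
    · obtain ⟨m, hm⟩ := hgx
      obtain ⟨p, hp, hxp⟩ := hx
      refine ⟨max m n, ⟨p, hp, fun i hi => hxp i (le_of_max_le_right hi)⟩, p, hp, fun i hi => ?_⟩
      rw [← hxp i (le_of_max_le_right hi)]
      exact (hm x rfl).2 i (le_of_max_le_left hi)
    · exact ⟨n, hx, hPT n (hP g hg x hgx)⟩
  refine exists_small_energy K T hT (finite_cotail P.finite_toSet)
    (∑ g ∈ K, (P.card * C g + P.card * C g⁻¹)) (fun g hg n => ?_) (fun g hg n x hx => ?_) F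
    (fun x hx => hPT 0 (Finset.mem_union_left _ hx)) ε hε
  · have hsub : smulBoundary g (T n) ⊆ {x | x ∈ T n ∧ g • x ∉ T n} ∪
        (g⁻¹ • ·) '' {x | x ∈ T n ∧ g⁻¹ • x ∉ T n} := by
      intro x hx
      by_cases h1 : x ∈ T n
      · exact Or.inl ⟨h1, fun h2 => hx ⟨fun _ => h2, fun _ => h1⟩⟩
      · have h2 : g • x ∈ T n := by
          by_contra h2
          exact hx ⟨fun h => absurd h h1, fun h => absurd h h2⟩
        exact Or.inr ⟨g • x, ⟨h2, by rwa [inv_smul_smul]⟩, inv_smul_smul g x⟩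
    refine (Set.encard_le_encard hsub).trans ((Set.encard_union_le _ _).trans ?_)
    refine (add_le_add (encard_exit_le (F := (g • ·)) (hC g) P n) ((Set.encard_image_le _ _).trans
      (encard_exit_le (F := (g⁻¹ • ·)) (hC g⁻¹) P n))).trans ?_
    rw [← Nat.cast_add, Nat.cast_le]
    exact Finset.single_le_sum (f := fun g => P.card * C g + P.card * C g⁻¹)
      (fun _ _ => Nat.zero_le _) hg
  · by_cases h1 : x ∈ T n
    · exact hinv g (Finset.mem_union_left _ hg) n x h1
    · have h2 : g • x ∈ T n := by
        by_contra h2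
        exact hx ⟨fun h => absurd h h1, fun h => absurd h h2⟩
      obtain ⟨m, hm1, hm2⟩ := hinv g⁻¹ (Finset.mem_union_right _ (Finset.mem_image_of_mem _ hg)) n
        _ h2
      exact ⟨m, by rwa [inv_smul_smul] at hm2, hm1⟩

/-- The group elements all of whose germs are tail germs form a locally finite group, so there is a
mean invariant under all of them. -/
theorem exists_mean_invariant_of_isTailAt [FaithfulSMul G D.PathSpace] :
    ∃ μ : Mean G, ∀ g : G, (∀ p : D.PathSpace, IsTailAt (g • ·) p) → μ.Invariant g := by
  classical
  let H : ℕ → Set G := fun n => {g | ∀ p : D.PathSpace, IsTailOn (g • ·) n p}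
  have hmono : Monotone H := fun m n hmn g hg p => (hg p).mono hmn
  have hmul : ∀ n, ∀ g ∈ H n, ∀ h ∈ H n, g * h ∈ H n := by
    intro n g hg h hh p
    convert (hh p).comp (hg (h • p)) using 1
    ext q : 1
    exact mul_smul g h q
  have hone : ∀ n, (1 : G) ∈ H n := fun n p q hq => by simpa using hq
  -- an element of `H n` is determined by its effect on the first `n` edges
  have hfin : ∀ n, (H n).Finite := by
    intro n
    refine Set.Finite.of_injOn (t := Set.univ)
      (f := fun g => Set.range fun p : D.PathSpace => (pathPrefix n p, pathPrefix n (g • p)))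
      (fun _ _ => trivial) ?_ Set.finite_univ
    intro g hg h hh hgh
    refine FaithfulSMul.eq_of_smul_eq_smul (α := D.PathSpace) fun p => ?_
    have hmem : (pathPrefix n p, pathPrefix n (g • p)) ∈
        Set.range fun p : D.PathSpace => (pathPrefix n p, pathPrefix n (h • p)) := by
      have hgh' : (Set.range fun p : D.PathSpace => (pathPrefix n p, pathPrefix n (g • p))) =
          Set.range fun p : D.PathSpace => (pathPrefix n p, pathPrefix n (h • p)) := hgh
      rw [← hgh']
      exact ⟨p, rfl⟩
    obtain ⟨q, hq⟩ := hmem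
    rw [Prod.mk.injEq] at hq
    refine PathSpace.ext_of_pathPrefix (n := n) ?_ fun i hi => ?_
    · rw [← hq.2]
      exact (hh p q hq.1).1
    · exact ((hg p p rfl).2 i hi).trans ((hh p p rfl).2 i hi).symm
  let s : ℕ → Finset G := fun n => (hfin n).toFinset
  have hs : ∀ {n g}, g ∈ s n ↔ g ∈ H n := fun {n g} => (hfin n).mem_toFinset
  have hcard : ∀ n, ((s n).card : ℝ) ≠ 0 := fun n =>
    Nat.cast_ne_zero.2 (Finset.card_ne_zero_of_mem (hs.2 (hone n)))
  let M : ℕ → Mean G := fun n => Mean.ofWeights (s n) (fun _ => ((s n).card : ℝ)⁻¹) id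
    (fun _ _ => by positivity) (by simp [hcard n])
  refine ⟨Mean.ulim (Ultrafilter.of atTop) M, fun g hg f hf => ?_⟩
  refine tendsto_nhds_unique_of_eventuallyEq (Mean.tendsto_ulim _ M (hf.comp _))
    (Mean.tendsto_ulim _ M hf) (Eventually.filter_mono (Ultrafilter.of_le atTop) ?_)
  obtain ⟨n, hn⟩ := exists_forall_isTailOn hg
  filter_upwards [eventually_ge_atTop n] with m hm
  change ∑ x ∈ s m, ((s m).card : ℝ)⁻¹ * f (g * x) = ∑ x ∈ s m, ((s m).card : ℝ)⁻¹ * f x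
  rw [← Finset.mul_sum, ← Finset.mul_sum]
  congr 1
  have himage : (s m).image (g * ·) = s m := by
    refine Finset.eq_of_subset_of_card_le (fun x hx => ?_) ?_
    · obtain ⟨y, hy, rfl⟩ := Finset.mem_image.1 hx
      exact hs.2 (hmul m g (hmono hm hn) y (hs.1 hy))
    · rw [Finset.card_image_of_injective _ (mul_right_injective g)]
  conv_rhs => rw [← himage, Finset.sum_image (mul_right_injective g).injOn]

end PathSpaceAction

/-! ### Stabilizers of finite sets of singular points -/

section Stabilizers

open BratteliDiagram

variable {D : BratteliDiagram} (G : Type*) [Group G] [MulAction G D.PathSpace]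
  [ContinuousConstSMul G D.PathSpace]

/-- The group elements that fix every point of `B` and whose germs at all other points are tail
germs. -/
def tailFixator (B : Finset D.PathSpace) : Subgroup G where
  carrier := {g | (∀ x ∈ B, g • x = x) ∧ ∀ x ∉ B, IsTailAt (g • ·) x}
  one_mem' := ⟨fun x _ => one_smul G x, fun x _ => isTailAt_one x⟩
  mul_mem' := by
    rintro g h ⟨hg, hg'⟩ ⟨hh, hh'⟩
    refine ⟨fun x hx => by rw [mul_smul, hh x hx, hg x hx], fun x hx => ?_⟩
    refine isTailAt_mul (hh' x hx) (hg' _ fun hx' => hx ?_)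
    have h1 := hh _ hx'
    rwa [MulAction.injective h h1] at hx'
  inv_mem' := by
    rintro g ⟨hg, hg'⟩
    refine ⟨fun x hx => by rw [inv_smul_eq_iff, hg x hx], fun x hx => ?_⟩
    have h1 := isTailAt_inv (hg' (g⁻¹ • x) fun hx' => hx ?_)
    · rwa [smul_inv_smul] at h1
    · have h1 := hg _ hx'
      rw [smul_inv_smul] at h1
      rwa [h1]

/-- The group elements that permute the points of `A` and whose germs at all other points are tail
germs. -/
def tailStabilizer (A : Finset D.PathSpace) : Subgroup G where
  carrier := {g | (∀ x, g • x ∈ A ↔ x ∈ A) ∧ ∀ x ∉ A, IsTailAt (g • ·) x}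
  one_mem' := ⟨fun x => by rw [one_smul], fun x _ => isTailAt_one x⟩
  mul_mem' := by
    rintro g h ⟨hg, hg'⟩ ⟨hh, hh'⟩
    refine ⟨fun x => by rw [mul_smul, hg, hh], fun x hx => ?_⟩
    exact isTailAt_mul (hh' x hx) (hg' _ fun hx' => hx ((hh x).1 hx'))
  inv_mem' := by
    rintro g ⟨hg, hg'⟩
    refine ⟨fun x => by rw [← hg, smul_inv_smul], fun x hx => ?_⟩
    have h1 := isTailAt_inv (hg' (g⁻¹ • x) fun hx' => hx (by rwa [← hg, smul_inv_smul] at hx'))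
    rwa [smul_inv_smul] at h1

variable {G}

/-- The homomorphism from a subgroup of the stabilizer of `x` to the isotropy group at `x`. Germs are
multiplied in the order in which they are applied, hence the inverse. -/
def Subgroup.toIsotropyGroup (H : Subgroup G) (x : D.PathSpace) (hx : ∀ g ∈ H, g • x = x) :
    H →* IsotropyGroup G x where
  toFun g := ActionGerm.mk (g : G)⁻¹ (by rw [inv_smul_eq_iff, hx _ g.2])
  map_one' := congrArg (Quotient.mk _) (Subtype.ext inv_one)
  map_mul' g h := congrArg (Quotient.mk _) (Subtype.ext (mul_inv_rev (g : G) h))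

theorem Subgroup.toIsotropyGroup_eq_one {H : Subgroup G} {x : D.PathSpace}
    {hx : ∀ g ∈ H, g • x = x} {g : H} (h : H.toIsotropyGroup x hx g = 1) :
    ∀ᶠ z in 𝓝 x, (g : G) • z = z := by
  have h1 : ∀ᶠ z in 𝓝 x, (g : G)⁻¹ • z = (1 : G) • z :=
    ActionGerm.mk_eq_mk_iff (h' := one_smul G x).1 h
  filter_upwards [h1] with z hz
  rw [one_smul, inv_smul_eq_iff] at hz
  exact hz.symm

/-- Invariant means for the kernel and for the target of a homomorphism give one for its source. -/
theorem exists_invariant_mean_of_hom {Γ Q X : Type*} [Group Γ] [Group Q] [MulAction Γ X]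
    (ρ : Γ →* Q) (m : Mean Q) (hm : ∀ q : Q, m.Invariant q)
    (hX : ∃ μ : Mean X, ∀ g : Γ, ρ g = 1 → μ.Invariant g) :
    ∃ μ : Mean X, ∀ g : Γ, μ.Invariant g := by
  let _ : MulAction Γ Q := MulAction.compHom Q ρ
  refine exists_invariant_mean_of_subgroupoid (Y := Q) (fun _ _ => True) (fun _ => trivial)
    (fun _ _ => trivial) (fun _ => trivial) m (fun g => hm (ρ g))
    (fun g f f' _ _ h => by rw [funext fun y => h y trivial]) fun y => ?_
  obtain ⟨μ, hμ⟩ := hX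
  refine ⟨μ, fun g hg _ => hμ g ?_⟩
  exact mul_eq_right.1 (show ρ g * y = y from hg)

theorem exists_invariant_mean_of_finite (Q : Type*) [Group Q] [Finite Q] :
    ∃ m : Mean Q, ∀ q : Q, m.Invariant q := by
  have := Fintype.ofFinite Q
  refine ⟨Mean.ofWeights Finset.univ (fun _ => (Fintype.card Q : ℝ)⁻¹) id
    (fun _ _ => by positivity) (by simp), fun q f _ => ?_⟩
  exact Fintype.sum_equiv (Equiv.mulLeft q) _ _ fun _ => rfl

/-- Induction on `B`: the elements with trivial germ at a point of `B` belong to the fixator of the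
set of the other points. -/
theorem exists_mean_invariant_of_mem_tailFixator [FaithfulSMul G D.PathSpace]
    (hisotropy : ∀ x : D.PathSpace, IsAmenableGroup (IsotropyGroup G x)) (B : Finset D.PathSpace) :
    ∃ μ : Mean G, ∀ g ∈ tailFixator G B, μ.Invariant g := by
  classical
  induction B using Finset.induction_on with
  | empty =>
    obtain ⟨μ, hμ⟩ := exists_mean_invariant_of_isTailAt (G := G) (D := D)
    exact ⟨μ, fun g hg => hμ g fun p => hg.2 p (Finset.notMem_empty p)⟩
  | insert x B hx ih =>
    obtain ⟨m, hm⟩ := (hisotropy x).exists_invariant_mean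
    obtain ⟨μ, hμ⟩ := ih
    obtain ⟨ν, hν⟩ := exists_invariant_mean_of_hom (X := G)
      ((tailFixator G (insert x B)).toIsotropyGroup x fun g hg =>
        hg.1 x (Finset.mem_insert_self x B)) m hm ⟨μ, fun g hg => hμ g <| by
      refine ⟨fun y hy => g.2.1 y (Finset.mem_insert_of_mem hy), fun y hy => ?_⟩
      by_cases hyx : y = x
      · rw [hyx]
        exact isTailAt_of_eventually_eq (Subgroup.toIsotropyGroup_eq_one hg)
      · exact g.2.2 y fun h => (Finset.mem_insert.1 h).elim hyx hy⟩
    exact ⟨ν, fun g hg => hν ⟨g, hg⟩⟩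

/-- The fixator of `A` is the kernel of the action of the stabilizer on the finite set `A`. -/
theorem exists_mean_invariant_of_mem_tailStabilizer [FaithfulSMul G D.PathSpace]
    (hisotropy : ∀ x : D.PathSpace, IsAmenableGroup (IsotropyGroup G x)) (A : Finset D.PathSpace) :
    ∃ μ : Mean G, ∀ g ∈ tailStabilizer G A, μ.Invariant g := by
  classical
  let _ : MulAction (tailStabilizer G A) A :=
    { smul := fun g a => ⟨(g : G) • (a : D.PathSpace), (g.2.1 a).2 a.2⟩
      one_smul := fun a => Subtype.ext (one_smul G (a : D.PathSpace))
      mul_smul := fun g h a => Subtype.ext (mul_smul (g : G) (h : G) (a : D.PathSpace)) }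
  obtain ⟨m, hm⟩ := exists_invariant_mean_of_finite (Equiv.Perm A)
  obtain ⟨μ, hμ⟩ := exists_mean_invariant_of_mem_tailFixator hisotropy A
  obtain ⟨ν, hν⟩ := exists_invariant_mean_of_hom (X := G)
    (MulAction.toPermHom (tailStabilizer G A) A) m hm
    ⟨μ, fun g hg => hμ g
      ⟨fun x hx => congrArg Subtype.val (Equiv.congr_fun hg ⟨x, hx⟩), g.2.2⟩⟩
  exact ⟨ν, fun g hg => hν ⟨g, hg⟩⟩

end Stabilizers

/-! ### Amenability of groups of bounded type -/

theorem mainTheorem3 (D : BratteliDiagram) (G : Type*) [Group G]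
    [MulAction G D.PathSpace] [FaithfulSMul G D.PathSpace] [ContinuousConstSMul G D.PathSpace]
    (hbounded : ∀ g : G, BratteliDiagram.IsBoundedType
      (Homeomorph.smul g : D.PathSpace ≃ₜ D.PathSpace))
    (hisotropy : ∀ x : D.PathSpace, IsAmenableGroup (IsotropyGroup G x)) :
    IsAmenableGroup G := by
  classical
  open scoped Pointwise in
  obtain ⟨m, hm, hmF⟩ := exists_invariant_mean_finset_pathSpace hbounded
  have hfin : ∀ g : G, {p : D.PathSpace | ¬ BratteliDiagram.IsTailAt (g • ·) p}.Finite :=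
    fun g => (hbounded g).2.subset fun p hp h => hp h.isTailAt
  -- the arrows `A → g A` for which `A` contains all singular points of `g`
  obtain ⟨μ, hμ⟩ := exists_invariant_mean_of_subgroupoid (Γ := G) (X := G)
    (fun (g : G) (A : Finset D.PathSpace) => ∀ x ∉ A, BratteliDiagram.IsTailAt (g • ·) x)
    (fun A x _ => isTailAt_one x)
    (fun {g h A} hg hh x hx => isTailAt_mul (hg x hx)
      (hh _ (mt (Finset.smul_mem_smul_finset_iff g).1 hx)))
    (fun {g A} hg x hx => by
      have h1 := isTailAt_inv (hg (g⁻¹ • x) (mt Finset.inv_smul_mem_iff.1 hx))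
      rwa [smul_inv_smul] at h1)
    m hm
    (fun g f f' hf hf' h => hmF (hfin g).toFinset f f' hf hf' fun A hA => h A fun x hx => by
      by_contra hgx
      exact hx (hA ((hfin g).mem_toFinset.2 hgx)))
    fun A => by
      obtain ⟨μ, hμ⟩ := exists_mean_invariant_of_mem_tailStabilizer hisotropy A
      refine ⟨μ, fun g hgA hg => hμ g ⟨fun x => ?_, hg⟩⟩
      conv_lhs => rw [← hgA]
      exact Finset.smul_mem_smul_finset_iff g
  exact IsAmenableAction.of_invariant_mean μ hμ
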